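/- Let $V$ be a finite-dimensional real inner product space and let $W$ be a finite group of linear isometries of $V$ that is generated by orthogonal reflections and acts irreducibly on $V$ (so $V\neq 0$). Let $T\subset W$ be the set of all reflections in $W$, let $\Phi$ be the set of unit normals to their reflecting hyperplanes, and let $\mathcal L$ be the set of flats, i.e. of all intersections of reflecting hyperplanes (including $V$ itself, the empty intersection). Let $c\in W$ be a Coxeter element, that is, a product $s_1s_2\cdots s_n$, in any order, of the reflections in the simple roots $\alpha_1,\dots,\alpha_n$ of some simple system of $\Phi$ (linearly independent roots such that every root is a linear combination of them with all coefficients $\ge 0$ or all coefficients $\le 0$), and let $C=\langle c\rangle$. For $w\in W$ let $V^w$ be its fixed space and let $\ell_T(w)$ be the least $k$ such that $w$ is a product of $k$ elements of $T$; write $u\le_T v$ if $\ell_T(v)=\ell_T(u)+\ell_T(u^{-1}v)$. A flat is called noncrossing if it has the form $V^w$ with $w\in W$ and $w\le_T c$. A line is a one-dimensional flat, and a noncrossing line is a one-dimensional noncrossing flat. Then for every noncrossing line $X$, the set of noncrossing lines in the $W$-orbit of $X$ is precisely the $C$-orbit of $X$. Moreover, the map $$C\backslash\{\text{noncrossing lines}\}\longrightarrow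 W\backslash\{\text{lines}\},\qquad C.X\longmapsto W.X,$$ is well defined and bijective. -/

import Mathlib

namespace NoncrossingLines

variable {V : Type*} [NormedAddCommGroup V] [InnerProductSpace ℝ V]

/-- The orthogonal reflection of `V` through the hyperplane `α^⊥` (for `α ≠ 0`). -/
noncomputable def hyperplaneReflection (α : V) : V ≃ₗᵢ[ℝ] V := (Submodule.span ℝ {α})ᗮ.reflection

/-- The set `T` of all reflections lying in `W`. -/
def reflections (W : Subgroup (V ≃ₗᵢ[ℝ] V)) : Set (V ≃ₗᵢ[ℝ] V) :=
  {t | t ∈ W ∧ ∃ α : V, α ≠ 0 ∧ t = hyperplaneReflection α}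

/-- The root system `Φ`: all unit normals to the reflecting hyperplanes of `W`. -/
def roots (W : Subgroup (V ≃ₗᵢ[ℝ] V)) : Set V :=
  {α | ‖α‖ = 1 ∧ hyperplaneReflection α ∈ W}

/-- `W` is a finite real reflection group acting irreducibly on `V`. -/
structure IsIrreducibleReflectionGroup (W : Subgroup (V ≃ₗᵢ[ℝ] V)) : Prop where
  finite : Finite W
  generated : Subgroup.closure (reflections W) = W
  nontrivial : Nontrivial V
  irreducible : ∀ U : Submodule ℝ V, (∀ w ∈ W, ∀ x ∈ U, w x ∈ U) → U = ⊥ ∨ U = ⊤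

/-- `α` is an (ordered) system of simple roots of `W`: linearly independent roots such that
every root is a combination of them with all coefficients `≥ 0` or all coefficients `≤ 0`. -/
structure IsSimpleSystem (W : Subgroup (V ≃ₗᵢ[ℝ] V)) {n : ℕ} (α : Fin n → V) : Prop where
  mem_roots : ∀ i, α i ∈ roots W
  linearIndependent : LinearIndependent ℝ α
  sign : ∀ β ∈ roots W, ∃ a : Fin n → ℝ,
    β = ∑ i, a i • α i ∧ ((∀ i, 0 ≤ a i) ∨ (∀ i, a i ≤ 0))

/-- A Coxeter element: the product, in some order, of the simple reflections attached to some
simple system. The simple system `α` is ordered, so every order of the product is covered. -/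
def IsCoxeterElement (W : Subgroup (V ≃ₗᵢ[ℝ] V)) (c : V ≃ₗᵢ[ℝ] V) : Prop :=
  ∃ (n : ℕ) (α : Fin n → V), IsSimpleSystem W α ∧
    c = (List.ofFn fun i => hyperplaneReflection (α i)).prod

/-- The reflection length `ℓ_T`, meaningful on elements of `W`. -/
noncomputable def reflectionLength (W : Subgroup (V ≃ₗᵢ[ℝ] V)) (w : V ≃ₗᵢ[ℝ] V) : ℕ :=
  sInf {k | ∃ l : List (V ≃ₗᵢ[ℝ] V), l.length = k ∧ (∀ t ∈ l, t ∈ reflections W) ∧ l.prod = w}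

/-- The absolute order `u ≤_T v`, for `u`, `v` in `W`. -/
def AbsoluteLE (W : Subgroup (V ≃ₗᵢ[ℝ] V)) (u v : V ≃ₗᵢ[ℝ] V) : Prop :=
  reflectionLength W v = reflectionLength W u + reflectionLength W (u⁻¹ * v)

/-- The fixed space `V^w`. -/
def fixedSpace (w : V ≃ₗᵢ[ℝ] V) : Submodule ℝ V :=
  LinearMap.eqLocus (w.toLinearEquiv : V →ₗ[ℝ] V) LinearMap.id

/-- The flats, i.e. the elements of the lattice `𝓛`: the intersections of sets of reflecting
hyperplanes (the empty intersection being `V`). -/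
def IsFlat (W : Subgroup (V ≃ₗᵢ[ℝ] V)) (X : Submodule ℝ V) : Prop :=
  ∃ A ⊆ roots W, X = ⨅ α ∈ A, (Submodule.span ℝ {α})ᗮ

/-- The noncrossing flats: the flats `V^w` with `w` in the interval `[1, c]_T` of `W`. -/
def IsNoncrossingFlat (W : Subgroup (V ≃ₗᵢ[ℝ] V)) (c : V ≃ₗᵢ[ℝ] V) (X : Submodule ℝ V) : Prop :=
  IsFlat W X ∧ ∃ w ∈ W, AbsoluteLE W w c ∧ X = fixedSpace w

/-- A line is a one-dimensional flat. -/
def IsLine (W : Subgroup (V ≃ₗᵢ[ℝ] V)) (X : Submodule ℝ V) : Prop :=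
  IsFlat W X ∧ Module.finrank ℝ X = 1

/-- A noncrossing line is a one-dimensional noncrossing flat. -/
def IsNoncrossingLine (W : Subgroup (V ≃ₗᵢ[ℝ] V)) (c : V ≃ₗᵢ[ℝ] V) (X : Submodule ℝ V) : Prop :=
  IsNoncrossingFlat W c X ∧ Module.finrank ℝ X = 1

/-- The translate `g X` of a subspace. -/
def translate (g : V ≃ₗᵢ[ℝ] V) (X : Submodule ℝ V) : Submodule ℝ V :=
  X.map (g.toLinearEquiv : V →ₗ[ℝ] V)

/-- The orbit `G.X` of a subspace under a group `G` of isometries. -/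
def orbit (G : Subgroup (V ≃ₗᵢ[ℝ] V)) (X : Submodule ℝ V) : Set (Submodule ℝ V) :=
  {Y | ∃ g ∈ G, Y = translate g X}

theorem translate_one (X : Submodule ℝ V) : translate 1 X = X := by
  exact Submodule.map_id X

theorem translate_mul (g h : V ≃ₗᵢ[ℝ] V) (X : Submodule ℝ V) :
    translate (g * h) X = translate g (translate h X) := by
  exact Submodule.map_comp (h.toLinearEquiv : V →ₗ[ℝ] V) (g.toLinearEquiv : V →ₗ[ℝ] V) X

/-- The relation "in the same `G`-orbit" on subspaces of `V`. -/
def orbitSetoid (G : Subgroup (V ≃ₗᵢ[ℝ] V)) : Setoid (Submodule ℝ V) where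
  r X Y := Y ∈ orbit G X
  iseqv :=
    { refl := fun X => ⟨1, G.one_mem, (translate_one X).symm⟩
      symm := by
        rintro X Y ⟨g, hg, rfl⟩
        exact ⟨g⁻¹, G.inv_mem hg, by rw [← translate_mul, inv_mul_cancel, translate_one]⟩
      trans := by
        rintro X Y Z ⟨g, hg, rfl⟩ ⟨h, hh, rfl⟩
        exact ⟨h * g, G.mul_mem hh hg, by rw [translate_mul]⟩ }

/-- The set of `W`-orbits of lines, `W \ {lines}`. -/
abbrev LineOrbits (W : Subgroup (V ≃ₗᵢ[ℝ] V)) : Type _ :=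
  Quotient ((orbitSetoid W).comap (Subtype.val : {X : Submodule ℝ V // IsLine W X} → _))

/-- The set of `C`-orbits of noncrossing lines, `C \ {noncrossing lines}`, with `C = ⟨c⟩`. -/
abbrev NoncrossingLineOrbits (W : Subgroup (V ≃ₗᵢ[ℝ] V)) (c : V ≃ₗᵢ[ℝ] V) : Type _ :=
  Quotient ((orbitSetoid (Subgroup.zpowers c)).comap
    (Subtype.val : {X : Submodule ℝ V // IsNoncrossingLine W c X} → _))

/-- The `W`-orbit of a line. -/
def lineOrbit (W : Subgroup (V ≃ₗᵢ[ℝ] V)) (X : Submodule ℝ V) (hX : IsLine W X) :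
    LineOrbits W :=
  Quotient.mk _ ⟨X, hX⟩

/-- The `C`-orbit of a noncrossing line. -/
def noncrossingLineOrbit (W : Subgroup (V ≃ₗᵢ[ℝ] V)) (c : V ≃ₗᵢ[ℝ] V) (X : Submodule ℝ V)
    (hX : IsNoncrossingLine W c X) : NoncrossingLineOrbits W c :=
  Quotient.mk _ ⟨X, hX⟩

theorem IsNoncrossingLine.isLine {W : Subgroup (V ≃ₗᵢ[ℝ] V)} {c : V ≃ₗᵢ[ℝ] V}
    {X : Submodule ℝ V} (hX : IsNoncrossingLine W c X) : IsLine W X :=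
  ⟨hX.1.1, hX.2⟩

end NoncrossingLines

namespace NoncrossingLines

variable {V : Type*} [NormedAddCommGroup V] [InnerProductSpace ℝ V]

/-! Let `c = s₁⋯sₙ`, and let `ω i` be the fundamental weights, with `s_i (ω i) = ω i - α i`. Both
sides of the correspondence are described by the lines `ℝ ω i`.

Every line has a dominant nonzero vector after moving it by `W`, and is then some `ℝ ω i`
(`exists_translate_eq_span_weight`). Deleting `s_i` from `c` gives an element below `c` with fixed
space `ℝ ω i`, so these lines are noncrossing and surjectivity follows.

The key observation is that `1 - c` is injective, commutes with `c`, and sends `ω i` to the root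
`s₁⋯s_{i-1} α_i`; these are the positive roots made negative by `c⁻¹`. A `c`-orbit of roots sums to
zero, so it changes sign and meets one of them (`exists_coxeter_pow_apply_eq`). If `V^w` is a
noncrossing line, comparison of lengths gives `c = w t` with `t` a reflection, so `1 - c` maps the
line into the span of a root. Transporting along the `c`-orbit of that root and cancelling `1 - c`
shows that noncrossing lines are exactly the `c`-translates of the `ℝ ω i`
(`isNoncrossingLine_iff`).

For injectivity, suppose `ℝ ω i` and `ℝ ω j` are `W`-conjugate. A positive scalar forces equality,
since the dominant chamber is a fundamental domain. A negative one reduces to this case because the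
`c`-orbit of `ω i` contains some `-ω k` (`span_weight_mem_orbit_coxeter`). -/

theorem mul_apply (g h : V ≃ₗᵢ[ℝ] V) (x : V) : (g * h) x = g (h x) := rfl

theorem one_apply (x : V) : (1 : V ≃ₗᵢ[ℝ] V) x = x := rfl

theorem inv_apply_self (g : V ≃ₗᵢ[ℝ] V) (x : V) : g⁻¹ (g x) = x := by
  rw [← mul_apply, inv_mul_cancel, one_apply]

theorem apply_inv_self (g : V ≃ₗᵢ[ℝ] V) (x : V) : g (g⁻¹ x) = x := by
  rw [← mul_apply, mul_inv_cancel, one_apply]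

/-! ### Reflections -/

theorem hyperplaneReflection_apply {α : V} (hα : ‖α‖ = 1) (x : V) :
    hyperplaneReflection α x = x - (2 * inner ℝ α x) • α := by
  rw [hyperplaneReflection, Submodule.reflection_orthogonal_apply,
    Submodule.reflection_singleton_apply, hα]
  simp only [RCLike.ofReal_real_eq_id, id, one_pow, div_one, two_smul]
  module

theorem hyperplaneReflection_mul_self (α : V) :
    hyperplaneReflection α * hyperplaneReflection α = 1 :=
  Submodule.reflection_mul_reflection _

theorem hyperplaneReflection_inv (α : V) :
    (hyperplaneReflection α)⁻¹ = hyperplaneReflection α :=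
  Submodule.reflection_inv

theorem hyperplaneReflection_smul {a : ℝ} (ha : a ≠ 0) (α : V) :
    hyperplaneReflection (a • α) = hyperplaneReflection α := by
  have h : Submodule.span ℝ {a • α} = Submodule.span ℝ {α} :=
    Submodule.span_singleton_smul_eq (IsUnit.mk0 a ha) α
  simp only [hyperplaneReflection, h]

theorem hyperplaneReflection_neg (α : V) :
    hyperplaneReflection (-α) = hyperplaneReflection α := by
  rw [← hyperplaneReflection_smul (neg_ne_zero.2 one_ne_zero) α, neg_one_smul]

theorem hyperplaneReflection_self {α : V} (hα : ‖α‖ = 1) :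
    hyperplaneReflection α α = -α := by
  rw [hyperplaneReflection_apply hα, real_inner_self_eq_norm_sq, hα]
  module

theorem conj_hyperplaneReflection {α : V} (hα : ‖α‖ = 1) (g : V ≃ₗᵢ[ℝ] V) :
    g * hyperplaneReflection α * g⁻¹ = hyperplaneReflection (g α) := by
  ext x
  have hi : inner ℝ α (g⁻¹ x) = inner ℝ (g α) x := by
    rw [← LinearIsometryEquiv.inner_map_map g, apply_inv_self]
  rw [mul_apply, mul_apply, hyperplaneReflection_apply hα,
    hyperplaneReflection_apply ((g.norm_map α).trans hα), map_sub, map_smul, apply_inv_self, hi]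

theorem neg_mem_roots {W : Subgroup (V ≃ₗᵢ[ℝ] V)} {α : V} (hα : α ∈ roots W) : -α ∈ roots W :=
  ⟨by rw [norm_neg]; exact hα.1, by rw [hyperplaneReflection_neg]; exact hα.2⟩

theorem apply_mem_roots {W : Subgroup (V ≃ₗᵢ[ℝ] V)} {g : V ≃ₗᵢ[ℝ] V} (hg : g ∈ W) {α : V}
    (hα : α ∈ roots W) : g α ∈ roots W :=
  ⟨(g.norm_map α).trans hα.1, by
    rw [← conj_hyperplaneReflection hα.1]
    exact W.mul_mem (W.mul_mem hg hα.2) (W.inv_mem hg)⟩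

theorem mem_reflections_iff {W : Subgroup (V ≃ₗᵢ[ℝ] V)} {t : V ≃ₗᵢ[ℝ] V} :
    t ∈ reflections W ↔ ∃ α ∈ roots W, t = hyperplaneReflection α := by
  constructor
  · rintro ⟨ht, α, hα, rfl⟩
    have h : hyperplaneReflection (‖α‖⁻¹ • α) = hyperplaneReflection α :=
      hyperplaneReflection_smul (inv_ne_zero (norm_ne_zero_iff.2 hα)) α
    exact ⟨‖α‖⁻¹ • α, ⟨norm_smul_inv_norm hα, by rwa [h]⟩, h.symm⟩
  · rintro ⟨α, hα, rfl⟩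
    exact ⟨hα.2, α, fun h => by simpa [h] using hα.1, rfl⟩

theorem conj_mem_reflections {W : Subgroup (V ≃ₗᵢ[ℝ] V)} {g : V ≃ₗᵢ[ℝ] V} (hg : g ∈ W)
    {t : V ≃ₗᵢ[ℝ] V} (ht : t ∈ reflections W) : g * t * g⁻¹ ∈ reflections W := by
  obtain ⟨α, hα, rfl⟩ := mem_reflections_iff.1 ht
  exact mem_reflections_iff.2 ⟨g α, apply_mem_roots hg hα, conj_hyperplaneReflection hα.1 g⟩

/-! ### Fixed spaces and reflection length -/

theorem mem_fixedSpace {w : V ≃ₗᵢ[ℝ] V} {x : V} : x ∈ fixedSpace w ↔ w x = x := Iff.rfl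

theorem fixedSpace_conj (g w : V ≃ₗᵢ[ℝ] V) :
    fixedSpace (g * w * g⁻¹) = translate g (fixedSpace w) := by
  ext x
  rw [mem_fixedSpace, translate, Submodule.mem_map]
  constructor
  · intro h
    refine ⟨g⁻¹ x, ?_, apply_inv_self g x⟩
    rw [mem_fixedSpace]
    conv_rhs => rw [← h]
    rw [mul_apply, mul_apply, inv_apply_self]
  · rintro ⟨y, hy, rfl⟩
    change (g * w * g⁻¹) (g y) = g y
    rw [mul_apply, mul_apply, inv_apply_self, mem_fixedSpace.1 hy]

theorem reflectionLength_le {W : Subgroup (V ≃ₗᵢ[ℝ] V)} {l : List (V ≃ₗᵢ[ℝ] V)}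
    (hl : ∀ t ∈ l, t ∈ reflections W) : reflectionLength W l.prod ≤ l.length :=
  Nat.sInf_le ⟨l, rfl, hl, rfl⟩

theorem exists_word {W : Subgroup (V ≃ₗᵢ[ℝ] V)} (hW : Subgroup.closure (reflections W) = W)
    {w : V ≃ₗᵢ[ℝ] V} (hw : w ∈ W) :
    ∃ l : List (V ≃ₗᵢ[ℝ] V), (∀ t ∈ l, t ∈ reflections W) ∧ l.prod = w := by
  rw [← hW] at hw
  induction hw using Subgroup.closure_induction_left with
  | one => exact ⟨[], by simp, rfl⟩
  | mul_left x hx y _ ih =>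
    obtain ⟨l, hl, rfl⟩ := ih
    exact ⟨x :: l, by simpa using ⟨hx, hl⟩, by simp⟩
  | inv_mul_cancel x hx y _ ih =>
    obtain ⟨l, hl, rfl⟩ := ih
    obtain ⟨α, -, rfl⟩ := mem_reflections_iff.1 hx
    exact ⟨hyperplaneReflection α :: l, by simpa using ⟨hx, hl⟩, by
      rw [hyperplaneReflection_inv, List.prod_cons]⟩

theorem exists_reduced_word {W : Subgroup (V ≃ₗᵢ[ℝ] V)}
    (hW : Subgroup.closure (reflections W) = W) {w : V ≃ₗᵢ[ℝ] V} (hw : w ∈ W) :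
    ∃ l : List (V ≃ₗᵢ[ℝ] V), l.length = reflectionLength W w ∧
      (∀ t ∈ l, t ∈ reflections W) ∧ l.prod = w := by
  obtain ⟨l, hl, rfl⟩ := exists_word hW hw
  exact Nat.sInf_mem (s := {k | ∃ l' : List (V ≃ₗᵢ[ℝ] V), l'.length = k ∧
    (∀ t ∈ l', t ∈ reflections W) ∧ l'.prod = l.prod}) ⟨l.length, l, rfl, hl, rfl⟩

/-- Each further reflection cuts the common fixed space by at most one dimension. This easy half of
Carter's lemma is all the proof needs about reflection length from below. -/
theorem finrank_le_fixedSpace_add_length [FiniteDimensional ℝ V] {W : Subgroup (V ≃ₗᵢ[ℝ] V)}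
    (l : List (V ≃ₗᵢ[ℝ] V)) (hl : ∀ t ∈ l, t ∈ reflections W) :
    Module.finrank ℝ V ≤ Module.finrank ℝ (fixedSpace l.prod) + l.length := by
  induction l with
  | nil =>
    have : fixedSpace (1 : V ≃ₗᵢ[ℝ] V) = ⊤ := by
      ext x; simp [mem_fixedSpace]
    rw [List.prod_nil, this, finrank_top]
    exact Nat.le_add_right _ _
  | cons t l ih =>
    have ih := ih fun t ht => hl t (by simp [ht])
    obtain ⟨α, hα, rfl⟩ := mem_reflections_iff.1 (hl t (by simp))
    have hle : fixedSpace l.prod ⊓ (Submodule.span ℝ {α})ᗮ ≤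
        fixedSpace (hyperplaneReflection α :: l).prod := by
      rintro x ⟨h1, h2⟩
      have h2 : inner ℝ α x = 0 := Submodule.mem_orthogonal_singleton_iff_inner_right.1 h2
      rw [mem_fixedSpace, List.prod_cons, mul_apply, mem_fixedSpace.1 h1,
        hyperplaneReflection_apply hα.1, h2]
      simp
    have h1 := Submodule.finrank_mono hle
    have h2 := Submodule.finrank_sup_add_finrank_inf_eq (fixedSpace l.prod)
      (Submodule.span ℝ {α})ᗮ
    have h3 := Submodule.finrank_le (fixedSpace l.prod ⊔ (Submodule.span ℝ {α})ᗮ)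
    have h4 := Submodule.finrank_add_finrank_orthogonal (Submodule.span ℝ {α})
    have h5 : Module.finrank ℝ (Submodule.span ℝ {α}) ≤ 1 :=
      (finrank_span_le_card {α}).trans (by simp)
    rw [List.length_cons]
    omega

theorem finrank_le_fixedSpace_add_reflectionLength [FiniteDimensional ℝ V]
    {W : Subgroup (V ≃ₗᵢ[ℝ] V)} (hW : Subgroup.closure (reflections W) = W) {w : V ≃ₗᵢ[ℝ] V}
    (hw : w ∈ W) :
    Module.finrank ℝ V ≤ Module.finrank ℝ (fixedSpace w) + reflectionLength W w := by
  obtain ⟨l, h1, h2, rfl⟩ := exists_reduced_word hW hw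
  rw [← h1]
  exact finrank_le_fixedSpace_add_length l h2

theorem reflectionLength_conj_le {W : Subgroup (V ≃ₗᵢ[ℝ] V)}
    (hW : Subgroup.closure (reflections W) = W) {g w : V ≃ₗᵢ[ℝ] V} (hg : g ∈ W) (hw : w ∈ W) :
    reflectionLength W (g * w * g⁻¹) ≤ reflectionLength W w := by
  obtain ⟨l, h1, h2, rfl⟩ := exists_reduced_word hW hw
  have h : (l.map (MulAut.conj g)).prod = g * l.prod * g⁻¹ := by
    rw [← map_list_prod, MulAut.conj_apply]
  rw [← h, ← h1, ← List.length_map (MulAut.conj g)]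
  refine reflectionLength_le fun t ht => ?_
  obtain ⟨s, hs, rfl⟩ := List.mem_map.1 ht
  exact conj_mem_reflections hg (h2 s hs)

theorem reflectionLength_conj {W : Subgroup (V ≃ₗᵢ[ℝ] V)}
    (hW : Subgroup.closure (reflections W) = W) {g w : V ≃ₗᵢ[ℝ] V} (hg : g ∈ W) (hw : w ∈ W) :
    reflectionLength W (g * w * g⁻¹) = reflectionLength W w := by
  refine le_antisymm (reflectionLength_conj_le hW hg hw) ?_
  have h := reflectionLength_conj_le hW (W.inv_mem hg)
    (W.mul_mem (W.mul_mem hg hw) (W.inv_mem hg))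
  rwa [show g⁻¹ * (g * w * g⁻¹) * g⁻¹⁻¹ = w by group] at h

/-! ### Translates of flats, lines and noncrossing lines -/

theorem translate_span_singleton (g : V ≃ₗᵢ[ℝ] V) (x : V) :
    translate g (Submodule.span ℝ {x}) = Submodule.span ℝ {g x} := by
  rw [translate, Submodule.map_span, Set.image_singleton]
  rfl

theorem mem_translate {g : V ≃ₗᵢ[ℝ] V} {X : Submodule ℝ V} {x : V} :
    x ∈ translate g X ↔ g⁻¹ x ∈ X := by
  rw [translate, Submodule.mem_map]
  constructor
  · rintro ⟨y, hy, rfl⟩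
    change g⁻¹ (g y) ∈ X
    rwa [inv_apply_self]
  · exact fun h => ⟨_, h, apply_inv_self g x⟩

theorem finrank_translate (g : V ≃ₗᵢ[ℝ] V) (X : Submodule ℝ V) :
    Module.finrank ℝ (translate g X) = Module.finrank ℝ X :=
  LinearEquiv.finrank_map_eq g.toLinearEquiv X

theorem mem_iInf_orthogonal {A : Set V} {x : V} :
    x ∈ (⨅ α ∈ A, (Submodule.span ℝ {α})ᗮ : Submodule ℝ V) ↔ ∀ α ∈ A, inner ℝ α x = 0 := by
  simp only [Submodule.mem_iInf, Submodule.mem_orthogonal_singleton_iff_inner_right]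

theorem IsFlat.translate {W : Subgroup (V ≃ₗᵢ[ℝ] V)} {g : V ≃ₗᵢ[ℝ] V} (hg : g ∈ W)
    {X : Submodule ℝ V} (hX : IsFlat W X) : IsFlat W (translate g X) := by
  obtain ⟨A, hA, rfl⟩ := hX
  refine ⟨g '' A, ?_, ?_⟩
  · rintro _ ⟨α, hα, rfl⟩
    exact apply_mem_roots hg (hA hα)
  · ext x
    rw [mem_translate, mem_iInf_orthogonal, mem_iInf_orthogonal, Set.forall_mem_image]
    refine forall₂_congr fun α _ => ?_
    rw [← LinearIsometryEquiv.inner_map_map g, apply_inv_self]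

theorem IsLine.translate {W : Subgroup (V ≃ₗᵢ[ℝ] V)} {g : V ≃ₗᵢ[ℝ] V} (hg : g ∈ W)
    {X : Submodule ℝ V} (hX : IsLine W X) : IsLine W (translate g X) :=
  ⟨hX.1.translate hg, (finrank_translate g X).trans hX.2⟩

/-- Conjugation by an element centralising `c` preserves reflection length and fixes `c`, hence
preserves the interval below `c`. -/
theorem IsNoncrossingLine.translate {W : Subgroup (V ≃ₗᵢ[ℝ] V)}
    (hW : Subgroup.closure (reflections W) = W) {c g : V ≃ₗᵢ[ℝ] V} (hc : c ∈ W) (hg : g ∈ W)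
    (hgc : g * c * g⁻¹ = c) {X : Submodule ℝ V} (hX : IsNoncrossingLine W c X) :
    IsNoncrossingLine W c (translate g X) := by
  obtain ⟨⟨hf, w, hw, hwc, rfl⟩, h1⟩ := hX
  refine ⟨⟨hf.translate hg, g * w * g⁻¹, W.mul_mem (W.mul_mem hg hw) (W.inv_mem hg), ?_,
    (fixedSpace_conj g w).symm⟩, (finrank_translate g _).trans h1⟩
  have h : (g * w * g⁻¹)⁻¹ * c = g * (w⁻¹ * c) * g⁻¹ := by
    conv_lhs => rw [← hgc]
    group
  rw [AbsoluteLE, h, reflectionLength_conj hW hg hw,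
    reflectionLength_conj hW hg (W.mul_mem (W.inv_mem hw) hc)]
  exact hwc

/-! ### Simple systems and fundamental weights -/

/-- A spanning simple system `α` together with its fundamental weights `ω`. -/
structure IsWeightedSystem (W : Subgroup (V ≃ₗᵢ[ℝ] V)) {n : ℕ} (α ω : Fin n → V) : Prop where
  mem_roots : ∀ i, α i ∈ roots W
  inner_weight : ∀ i j, inner ℝ (ω i) (α j) = if i = j then 1 / 2 else 0
  expand : ∀ x, x = ∑ i, (2 * inner ℝ (ω i) x) • α i
  sign : ∀ β ∈ roots W, (∀ i, 0 ≤ inner ℝ (ω i) β) ∨ (∀ i, inner ℝ (ω i) β ≤ 0)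

theorem IsSimpleSystem.exists_weights [FiniteDimensional ℝ V] {W : Subgroup (V ≃ₗᵢ[ℝ] V)} {n : ℕ}
    {α : Fin n → V} (hα : IsSimpleSystem W α) (hs : ⊤ ≤ Submodule.span ℝ (Set.range α)) :
    ∃ ω : Fin n → V, IsWeightedSystem W α ω := by
  let b := Module.Basis.mk hα.linearIndependent hs
  have hb : ∀ i, b i = α i := fun i => Module.Basis.mk_apply hα.linearIndependent hs i
  -- The factor `1 / 2` makes `ω` dual to the coroots, which are `2 • α i` because roots are unit
  -- vectors.
  let ω : Fin n → V := fun i => (InnerProductSpace.toDual ℝ V).symm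
    ((1 / 2 : ℝ) • (b.coord i).toContinuousLinearMap)
  have hω : ∀ i x, inner ℝ (ω i) x = 1 / 2 * b.repr x i := by
    intro i x
    simp [ω, real_inner_smul_left, InnerProductSpace.toDual_symm_apply]
  refine ⟨ω, hα.mem_roots, ?_, ?_, ?_⟩
  · intro i j
    rw [hω, ← hb j, Module.Basis.repr_self, Finsupp.single_apply]
    by_cases h : j = i
    · simp [h]
    · simp [h, Ne.symm h]
  · intro x
    conv_lhs => rw [← b.sum_repr x]
    refine Finset.sum_congr rfl fun i _ => ?_
    rw [hω, hb]
    congr 1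
    ring
  · intro β hβ
    obtain ⟨a, ha, h⟩ := hα.sign β hβ
    have hc : ∀ i, inner ℝ (ω i) β = 1 / 2 * a i := by
      intro i
      rw [hω, ha]
      simp_rw [← hb]
      rw [b.repr_sum_self]
    refine h.imp (fun h i => ?_) (fun h i => ?_)
    · rw [hc]; linarith [h i]
    · rw [hc]; linarith [h i]

/-- `β` is a nonnegative combination of the simple roots with fundamental weights `ω`. -/
def IsPositive {n : ℕ} (ω : Fin n → V) (β : V) : Prop := ∀ i, 0 ≤ inner ℝ (ω i) β

/-- `x` lies in the closed dominant chamber. -/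
def IsDominant {n : ℕ} (α : Fin n → V) (x : V) : Prop := ∀ i, 0 ≤ inner ℝ (α i) x

/-- The product of the simple reflections along a word. -/
noncomputable def wordProd {n : ℕ} (α : Fin n → V) (l : List (Fin n)) : V ≃ₗᵢ[ℝ] V :=
  (l.map fun i => hyperplaneReflection (α i)).prod

/-- The Coxeter element attached to the order of the simple system. -/
noncomputable def coxeter {n : ℕ} (α : Fin n → V) : V ≃ₗᵢ[ℝ] V :=
  wordProd α (List.finRange n)

/-! ### Words in simple reflections -/

section Words

variable {n : ℕ} (α : Fin n → V)

theorem wordProd_nil : wordProd α [] = 1 := rfl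

theorem wordProd_cons (i : Fin n) (l : List (Fin n)) :
    wordProd α (i :: l) = hyperplaneReflection (α i) * wordProd α l := by
  simp [wordProd]

theorem wordProd_append (l m : List (Fin n)) :
    wordProd α (l ++ m) = wordProd α l * wordProd α m := by
  simp [wordProd]

theorem wordProd_singleton (i : Fin n) : wordProd α [i] = hyperplaneReflection (α i) := by
  simp [wordProd]

theorem wordProd_inv (l : List (Fin n)) : (wordProd α l)⁻¹ = wordProd α l.reverse := by
  induction l with
  | nil => simp [wordProd]
  | cons i l ih =>
    rw [wordProd_cons, mul_inv_rev, ih, hyperplaneReflection_inv, List.reverse_cons,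
      wordProd_append, wordProd_singleton]

end Words

namespace IsWeightedSystem

variable {W : Subgroup (V ≃ₗᵢ[ℝ] V)} {n : ℕ} {α ω : Fin n → V}

theorem wordProd_mem (h : IsWeightedSystem W α ω) (l : List (Fin n)) : wordProd α l ∈ W := by
  refine W.list_prod_mem fun x hx => ?_
  obtain ⟨i, -, rfl⟩ := List.mem_map.1 hx
  exact (h.mem_roots i).2

theorem inner_eq_sum (h : IsWeightedSystem W α ω) (x y : V) :
    inner ℝ x y = ∑ i, 2 * inner ℝ (ω i) x * inner ℝ (α i) y := by
  conv_lhs => rw [h.expand x, sum_inner]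
  simp_rw [real_inner_smul_left]

theorem eq_zero_of_inner_weight (h : IsWeightedSystem W α ω) {x : V}
    (hx : ∀ i, inner ℝ (ω i) x = 0) : x = 0 := by
  rw [h.expand x]
  simp [hx]

theorem eq_zero_of_inner_root (h : IsWeightedSystem W α ω) {x : V}
    (hx : ∀ i, inner ℝ (α i) x = 0) : x = 0 := by
  rw [← inner_self_eq_zero (𝕜 := ℝ), h.inner_eq_sum x x]
  simp [hx]

/-- The expansion of a vector in the fundamental weights. -/
theorem eq_smul_weight (h : IsWeightedSystem W α ω) {x : V} {i : Fin n}
    (hx : ∀ j, j ≠ i → inner ℝ (α j) x = 0) : x = (2 * inner ℝ (α i) x) • ω i := by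
  rw [← sub_eq_zero]
  refine h.eq_zero_of_inner_root fun j => ?_
  rw [inner_sub_right, real_inner_smul_right, real_inner_comm, real_inner_comm (ω i),
    h.inner_weight]
  by_cases hj : i = j
  · subst hj
    rw [if_pos rfl, real_inner_comm]
    ring
  · rw [if_neg hj, real_inner_comm, hx j (Ne.symm hj)]
    ring

theorem weight_ne_zero (h : IsWeightedSystem W α ω) (i : Fin n) : ω i ≠ 0 := by
  intro h0
  have := h.inner_weight i i
  rw [h0, inner_zero_left, if_pos rfl] at this
  norm_num at this

theorem isPositive_simple (h : IsWeightedSystem W α ω) (i : Fin n) : IsPositive ω (α i) := by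
  intro j
  rw [h.inner_weight]
  split_ifs <;> norm_num

theorem isDominant_weight (h : IsWeightedSystem W α ω) (i : Fin n) : IsDominant α (ω i) := by
  intro j
  rw [real_inner_comm, h.inner_weight]
  split_ifs <;> norm_num

theorem isPositive_or_neg (h : IsWeightedSystem W α ω) {β : V} (hβ : β ∈ roots W) :
    IsPositive ω β ∨ IsPositive ω (-β) := by
  refine (h.sign β hβ).imp id fun h i => ?_
  rw [inner_neg_right]
  linarith [h i]

theorem not_isPositive_neg (h : IsWeightedSystem W α ω) {β : V} (hβ : β ≠ 0)
    (hp : IsPositive ω β) : ¬ IsPositive ω (-β) := by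
  intro hn
  refine hβ (h.eq_zero_of_inner_weight fun i => le_antisymm ?_ (hp i))
  have := hn i
  rw [inner_neg_right] at this
  linarith

theorem ne_zero_of_mem_roots {β : V} (hβ : β ∈ roots W) : β ≠ 0 := by
  rintro rfl
  simpa using hβ.1

theorem simple_apply (h : IsWeightedSystem W α ω) (i : Fin n) (x : V) :
    hyperplaneReflection (α i) x = x - (2 * inner ℝ (α i) x) • α i :=
  hyperplaneReflection_apply (h.mem_roots i).1 x

theorem simple_apply_of_inner_eq_zero (h : IsWeightedSystem W α ω) {i : Fin n} {x : V}
    (hx : inner ℝ (α i) x = 0) : hyperplaneReflection (α i) x = x := by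
  rw [h.simple_apply, hx]
  simp

theorem inner_weight_simple_apply (h : IsWeightedSystem W α ω) {i j : Fin n} (hij : j ≠ i)
    (x : V) : inner ℝ (ω j) (hyperplaneReflection (α i) x) = inner ℝ (ω j) x := by
  rw [h.simple_apply, inner_sub_right, real_inner_smul_right, h.inner_weight, if_neg hij]
  ring

theorem inner_weight_self_simple_apply (h : IsWeightedSystem W α ω) (i : Fin n) (x : V) :
    inner ℝ (ω i) (hyperplaneReflection (α i) x) = inner ℝ (ω i) x - inner ℝ (α i) x := by
  rw [h.simple_apply, inner_sub_right, real_inner_smul_right, h.inner_weight, if_pos rfl]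
  ring

/-- A simple reflection permutes the other positive roots. -/
theorem isPositive_simple_apply (h : IsWeightedSystem W α ω) {β : V} (hβ : β ∈ roots W)
    (hp : IsPositive ω β) {i : Fin n} (hne : β ≠ α i) :
    IsPositive ω (hyperplaneReflection (α i) β) := by
  refine (h.isPositive_or_neg (apply_mem_roots (h.mem_roots i).2 hβ)).resolve_right fun hn => hne ?_
  -- The reflection changes only the `i`-th coordinate, so if the image were negative all other
  -- coordinates of `β` would vanish; unit length then leaves only `β = α i`.
  have h0 : ∀ j, j ≠ i → inner ℝ (ω j) β = 0 := by
    intro j hj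
    have := hn j
    rw [inner_neg_right, h.inner_weight_simple_apply hj] at this
    exact le_antisymm (by linarith) (hp j)
  have hb : β = (2 * inner ℝ (ω i) β) • α i := by
    conv_lhs => rw [h.expand β]
    refine Finset.sum_eq_single i (fun j _ hj => ?_) (by simp)
    rw [h0 j hj]
    simp
  have h1 : 2 * inner ℝ (ω i) β = 1 := by
    have := hβ.1
    rw [hb, norm_smul, (h.mem_roots i).1, mul_one, Real.norm_eq_abs,
      abs_of_nonneg (by linarith [hp i])] at this
    exact this
  rw [hb, h1, one_smul]

/-- The positive roots made negative by the inverse of a word come from its prefixes. -/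
theorem exists_prefix_of_neg (h : IsWeightedSystem W α ω) (l : List (Fin n)) {β : V}
    (hβ : β ∈ roots W) (hp : IsPositive ω β) (hn : IsPositive ω (-((wordProd α l)⁻¹ β))) :
    ∃ l₁ i l₂, l = l₁ ++ i :: l₂ ∧ β = wordProd α l₁ (α i) := by
  induction l generalizing β with
  | nil =>
    rw [wordProd_nil, inv_one, one_apply] at hn
    exact absurd hn (h.not_isPositive_neg (ne_zero_of_mem_roots hβ) hp)
  | cons i l ih =>
    -- Either the first letter makes `β` negative, so `β = α i`, or it keeps `β` positive and the
    -- tail of the word does so.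
    by_cases hi : β = α i
    · exact ⟨[], i, l, rfl, by rw [wordProd_nil, one_apply, hi]⟩
    · rw [wordProd_cons, mul_inv_rev, mul_apply, hyperplaneReflection_inv] at hn
      obtain ⟨l₁, j, l₂, rfl, he⟩ := ih (apply_mem_roots (h.mem_roots i).2 hβ)
        (h.isPositive_simple_apply hβ hp hi) hn
      refine ⟨i :: l₁, j, l₂, rfl, ?_⟩
      rw [wordProd_cons, mul_apply, ← he, ← mul_apply, hyperplaneReflection_mul_self, one_apply]

/-- The exchange property. -/
theorem exchange (h : IsWeightedSystem W α ω) (l : List (Fin n)) (k : Fin n)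
    (hn : IsPositive ω (-(wordProd α l (α k)))) :
    ∃ l', l'.length < l.length ∧ wordProd α l * hyperplaneReflection (α k) = wordProd α l' := by
  have hn' : IsPositive ω (-((wordProd α l.reverse)⁻¹ (α k))) := by
    rwa [wordProd_inv, List.reverse_reverse]
  obtain ⟨l₁, i, l₂, hl, he⟩ :=
    h.exists_prefix_of_neg l.reverse (h.mem_roots k) (h.isPositive_simple k) hn'
  have hl' : l = l₂.reverse ++ i :: l₁.reverse := by
    rw [← List.reverse_reverse l, hl]
    simp
  refine ⟨l₂.reverse ++ l₁.reverse, ?_, ?_⟩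
  · rw [hl']
    simp
  -- The last reflection is a conjugate of the letter `i` by the prefix `l₁`, so multiplying by it
  -- deletes that letter.
  · rw [he, ← conj_hyperplaneReflection (h.mem_roots i).1, hl', wordProd_append, wordProd_cons,
      wordProd_append, ← wordProd_inv α l₁]
    calc _ = wordProd α l₂.reverse * (hyperplaneReflection (α i) * hyperplaneReflection (α i)) *
        (wordProd α l₁)⁻¹ := by group
      _ = _ := by rw [hyperplaneReflection_mul_self, mul_one]

/-! ### The dominant chamber as a fundamental domain -/

/-- Two dominant vectors in the same orbit under words in simple reflections are equal. -/
theorem eq_of_isDominant_wordProd (h : IsWeightedSystem W α ω) {x : V} (hx : IsDominant α x) :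
    ∀ (N : ℕ) (l : List (Fin n)), l.length ≤ N → IsDominant α (wordProd α l x) →
      wordProd α l x = x := by
  intro N
  induction N with
  | zero =>
    intro l hl _
    rw [List.length_eq_zero_iff.1 (Nat.le_zero.1 hl)]
    rfl
  | succ N ih =>
    intro l hl hd
    rcases List.eq_nil_or_concat l with rfl | ⟨l, k, rfl⟩
    · rfl
    rw [List.concat_eq_append] at hl hd ⊢
    rw [wordProd_append, wordProd_singleton] at hd ⊢
    rw [List.length_append, List.length_singleton] at hl
    rcases h.isPositive_or_neg (apply_mem_roots (h.wordProd_mem l) (h.mem_roots k)) with hp | hn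
    -- A positive root pairs nonnegatively with a dominant vector, but this pairing is `-⟪α k, x⟫ ≤
    -- 0`; so `x` is fixed by the last letter, which can be dropped.
    · have h1 : 0 ≤ inner ℝ (wordProd α l (α k))
          ((wordProd α l * hyperplaneReflection (α k)) x) := by
        rw [h.inner_eq_sum]
        refine Finset.sum_nonneg fun i _ => mul_nonneg ?_ (hd i)
        linarith [hp i]
      have h2 : inner ℝ (wordProd α l (α k)) ((wordProd α l * hyperplaneReflection (α k)) x) =
          - inner ℝ (α k) x := by
        rw [mul_apply, LinearIsometryEquiv.inner_map_map,
          ← LinearIsometryEquiv.inner_map_map (hyperplaneReflection (α k)),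
          hyperplaneReflection_self (h.mem_roots k).1, ← mul_apply, hyperplaneReflection_mul_self,
          one_apply, inner_neg_left]
      have h3 : hyperplaneReflection (α k) x = x :=
        h.simple_apply_of_inner_eq_zero (le_antisymm (by linarith) (hx k))
      rw [mul_apply, h3] at hd ⊢
      exact ih l (by omega) hd
    · obtain ⟨l', hl', he⟩ := h.exchange l k hn
      rw [he] at hd ⊢
      exact ih l' (by omega) hd

/-- Pairing with the sum of the weights is the height function: maximising it over an orbit yields a
dominant vector, and minimising it over positive roots yields a simple root. -/
theorem inner_sum_weight (h : IsWeightedSystem W α ω) (i : Fin n) (x : V) :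
    inner ℝ (∑ j, ω j) (hyperplaneReflection (α i) x) =
      inner ℝ (∑ j, ω j) x - inner ℝ (α i) x := by
  have h1 : inner ℝ (∑ j, ω j) (α i) = (1 / 2 : ℝ) := by
    rw [sum_inner]
    simp [h.inner_weight]
  rw [h.simple_apply, inner_sub_right, real_inner_smul_right, h1]
  ring

/-- Every vector can be moved into the dominant chamber. -/
theorem exists_isDominant (h : IsWeightedSystem W α ω) [Finite W] (x : V) :
    ∃ w ∈ W, IsDominant α (w x) := by
  obtain ⟨w, hw, hmax⟩ := Set.exists_max_image (W : Set (V ≃ₗᵢ[ℝ] V))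
    (fun w => inner ℝ (∑ j, ω j) (w x)) (Set.toFinite _) ⟨1, W.one_mem⟩
  refine ⟨w, hw, fun i => ?_⟩
  have := hmax _ (W.mul_mem (h.mem_roots i).2 hw)
  rw [mul_apply, h.inner_sum_weight] at this
  linarith

theorem exists_inner_pos (h : IsWeightedSystem W α ω) {β : V} (hβ : β ∈ roots W)
    (hp : IsPositive ω β) : ∃ i, 0 < inner ℝ (α i) β := by
  by_contra! hc
  have h1 : inner ℝ β β = (1 : ℝ) := by
    rw [real_inner_self_eq_norm_sq, hβ.1]
    norm_num
  have h2 : inner ℝ β β ≤ (0 : ℝ) := by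
    rw [h.inner_eq_sum]
    refine Finset.sum_nonpos fun i _ => mul_nonpos_of_nonneg_of_nonpos ?_ (hc i)
    linarith [hp i]
  linarith

/-- Every positive root is conjugate to a simple root under words in simple reflections. -/
theorem exists_wordProd_apply_eq_simple (h : IsWeightedSystem W α ω) [Finite W] {β : V}
    (hβ : β ∈ roots W) (hp : IsPositive ω β) : ∃ l i, wordProd α l β = α i := by
  obtain ⟨w, ⟨hw, ⟨l, rfl⟩, hwp⟩, hmin⟩ := Set.exists_min_image
    {w : V ≃ₗᵢ[ℝ] V | w ∈ W ∧ (∃ l, w = wordProd α l) ∧ IsPositive ω (w β)}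
    (fun w => inner ℝ (∑ j, ω j) (w β))
    (Set.Finite.subset (Set.toFinite (W : Set (V ≃ₗᵢ[ℝ] V))) fun w hw => hw.1)
    ⟨1, W.one_mem, ⟨[], rfl⟩, hp⟩
  have hr := apply_mem_roots hw hβ
  obtain ⟨i, hi⟩ := h.exists_inner_pos hr hwp
  refine ⟨l, i, ?_⟩
  by_contra hne
  have := hmin (wordProd α (i :: l)) ⟨h.wordProd_mem _, ⟨_, rfl⟩, by
    rw [wordProd_cons, mul_apply]
    exact h.isPositive_simple_apply hr hwp hne⟩
  rw [wordProd_cons, mul_apply, h.inner_sum_weight] at this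
  linarith

theorem exists_wordProd_eq_reflection (h : IsWeightedSystem W α ω) [Finite W] {β : V}
    (hβ : β ∈ roots W) : ∃ l, hyperplaneReflection β = wordProd α l := by
  wlog hp : IsPositive ω β generalizing β
  · rw [← hyperplaneReflection_neg]
    exact this (neg_mem_roots hβ) ((h.isPositive_or_neg hβ).resolve_left hp)
  obtain ⟨l, i, hl⟩ := h.exists_wordProd_apply_eq_simple hβ hp
  refine ⟨l.reverse ++ i :: l, ?_⟩
  rw [wordProd_append, wordProd_cons, ← hl, ← conj_hyperplaneReflection hβ.1, ← wordProd_inv]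
  group

/-- A finite reflection group is generated by its simple reflections. -/
theorem exists_wordProd_eq (h : IsWeightedSystem W α ω) [Finite W]
    (hW : Subgroup.closure (reflections W) = W) {w : V ≃ₗᵢ[ℝ] V} (hw : w ∈ W) :
    ∃ l, w = wordProd α l := by
  rw [← hW] at hw
  induction hw using Subgroup.closure_induction with
  | mem x hx =>
    obtain ⟨β, hβ, rfl⟩ := mem_reflections_iff.1 hx
    exact h.exists_wordProd_eq_reflection hβ
  | one => exact ⟨[], rfl⟩
  | mul x y _ _ hx hy =>
    obtain ⟨l, rfl⟩ := hx
    obtain ⟨m, rfl⟩ := hy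
    exact ⟨l ++ m, (wordProd_append α l m).symm⟩
  | inv x _ hx =>
    obtain ⟨l, rfl⟩ := hx
    exact ⟨l.reverse, wordProd_inv α l⟩

theorem eq_of_isDominant (h : IsWeightedSystem W α ω) [Finite W]
    (hW : Subgroup.closure (reflections W) = W) {w : V ≃ₗᵢ[ℝ] V} (hw : w ∈ W) {x : V}
    (hx : IsDominant α x) (hwx : IsDominant α (w x)) : w x = x := by
  obtain ⟨l, rfl⟩ := h.exists_wordProd_eq hW hw
  exact h.eq_of_isDominant_wordProd hx _ l le_rfl hwx

/-- A root orthogonal to a dominant vector `y` is orthogonal to every fundamental weight of a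
simple root not orthogonal to `y`. -/
theorem inner_weight_eq_zero (h : IsWeightedSystem W α ω) {y : V} (hy : IsDominant α y)
    {β : V} (hβ : β ∈ roots W) (hβy : inner ℝ β y = 0) {i : Fin n} (hi : inner ℝ (α i) y ≠ 0) :
    inner ℝ (ω i) β = 0 := by
  wlog hp : IsPositive ω β generalizing β
  · have := this (neg_mem_roots hβ) (by rw [inner_neg_left, hβy, neg_zero])
      ((h.isPositive_or_neg hβ).resolve_left hp)
    rwa [inner_neg_right, neg_eq_zero] at this
  rw [h.inner_eq_sum, Finset.sum_eq_zero_iff_of_nonneg] at hβy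
  · have := hβy i (Finset.mem_univ i)
    simpa [hi] using this
  · intro j _
    exact mul_nonneg (by linarith [hp j]) (hy j)

/-- Once the line contains a dominant `y ≠ 0`, pick `i` with `⟪α i, y⟫ ≠ 0`. Every root defining the
flat is orthogonal to `y`, hence to `ω i`, so the flat contains `ω i`. -/
theorem exists_translate_eq_span_weight (h : IsWeightedSystem W α ω) [Finite W]
    {X : Submodule ℝ V} (hX : IsLine W X) :
    ∃ w ∈ W, ∃ i, translate w X = Submodule.span ℝ {ω i} := by
  obtain ⟨x, hx, hx0⟩ : ∃ x ∈ X, x ≠ 0 := by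
    have : X ≠ ⊥ := by
      rintro rfl
      simpa using hX.2
    exact X.ne_bot_iff.1 this
  obtain ⟨w, hw, hd⟩ := h.exists_isDominant x
  refine ⟨w, hw, ?_⟩
  have hwX := hX.translate hw
  have hmem : w x ∈ translate w X := mem_translate.2 (by rwa [inv_apply_self])
  obtain ⟨i, hi⟩ : ∃ i, inner ℝ (α i) (w x) ≠ 0 := by
    by_contra! hc
    have := h.eq_zero_of_inner_root hc
    rw [map_eq_zero_iff _ w.injective] at this
    exact hx0 this
  obtain ⟨⟨A, hA, hXA⟩, h1⟩ := hwX
  refine ⟨i, Eq.symm ?_⟩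
  rw [hXA] at hmem h1 ⊢
  have hle : Submodule.span ℝ {ω i} ≤ ⨅ α ∈ A, (Submodule.span ℝ {α})ᗮ := by
    rw [Submodule.span_singleton_le_iff_mem, mem_iInf_orthogonal]
    intro β hβ
    rw [real_inner_comm]
    exact h.inner_weight_eq_zero hd (hA hβ) (mem_iInf_orthogonal.1 hmem β hβ) hi
  have : FiniteDimensional ℝ (⨅ α ∈ A, (Submodule.span ℝ {α})ᗮ : Submodule ℝ V) :=
    FiniteDimensional.of_finrank_pos (by omega)
  refine Submodule.eq_of_le_of_finrank_eq hle ?_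
  rw [h1, finrank_span_singleton (h.weight_ne_zero i)]

/-! ### Products of distinct simple reflections -/

theorem inner_weight_wordProd (h : IsWeightedSystem W α ω) {i : Fin n} {l : List (Fin n)}
    (hi : i ∉ l) (x : V) : inner ℝ (ω i) (wordProd α l x) = inner ℝ (ω i) x := by
  induction l with
  | nil => rfl
  | cons j l ih =>
    rw [List.mem_cons, not_or] at hi
    rw [wordProd_cons, mul_apply, h.inner_weight_simple_apply hi.1, ih hi.2]

theorem wordProd_apply_of_inner_eq_zero (h : IsWeightedSystem W α ω) {l : List (Fin n)} {x : V}
    (hx : ∀ i ∈ l, inner ℝ (α i) x = 0) : wordProd α l x = x := by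
  induction l with
  | nil => rfl
  | cons j l ih =>
    rw [wordProd_cons, mul_apply, ih fun i hi => hx i (by simp [hi])]
    exact h.simple_apply_of_inner_eq_zero (hx j (by simp))

theorem wordProd_weight (h : IsWeightedSystem W α ω) {i : Fin n} {l : List (Fin n)}
    (hi : i ∉ l) : wordProd α l (ω i) = ω i := by
  refine h.wordProd_apply_of_inner_eq_zero fun j hj => ?_
  rw [real_inner_comm, h.inner_weight, if_neg]
  rintro rfl
  exact hi hj

/-- A product of distinct simple reflections fixes only what each of them fixes. -/
theorem inner_eq_zero_of_wordProd_apply (h : IsWeightedSystem W α ω) {l : List (Fin n)}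
    (hl : l.Nodup) {x : V} (hx : wordProd α l x = x) : ∀ i ∈ l, inner ℝ (α i) x = 0 := by
  induction l with
  | nil => simp
  | cons j l ih =>
    rw [List.nodup_cons] at hl
    rw [wordProd_cons, mul_apply] at hx
    -- Compare `ω j`-coordinates: the tail omits `j` and preserves this coordinate, while the
    -- reflection in `α j` lowers it by `⟪α j, x⟫`.
    have h1 : inner ℝ (α j) x = 0 := by
      have h2 : wordProd α l x = hyperplaneReflection (α j) x := by
        conv_rhs => rw [← hx, ← mul_apply, hyperplaneReflection_mul_self, one_apply]
      have h3 := h.inner_weight_wordProd hl.1 x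
      rw [h2, h.inner_weight_self_simple_apply] at h3
      linarith
    have h2 : wordProd α l x = x := by
      have h4 := h.simple_apply_of_inner_eq_zero h1
      conv_rhs at hx => rw [← h4]
      exact (hyperplaneReflection (α j)).injective hx
    intro i hi
    rcases List.mem_cons.1 hi with rfl | hi
    · exact h1
    · exact ih hl.2 h2 i hi

/-! ### Coxeter elements -/

theorem coxeter_mem (h : IsWeightedSystem W α ω) : coxeter α ∈ W := h.wordProd_mem _

theorem eq_zero_of_coxeter_apply (h : IsWeightedSystem W α ω) {x : V} (hx : coxeter α x = x) :
    x = 0 :=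
  h.eq_zero_of_inner_root fun i =>
    h.inner_eq_zero_of_wordProd_apply (List.nodup_finRange n) hx i (List.mem_finRange i)

theorem eq_of_sub_coxeter_eq (h : IsWeightedSystem W α ω) {x y : V}
    (hxy : x - coxeter α x = y - coxeter α y) : x = y := by
  rw [← sub_eq_zero]
  refine h.eq_zero_of_coxeter_apply ?_
  rw [map_sub]
  exact (sub_eq_sub_iff_sub_eq_sub.1 hxy).symm

theorem not_mem_of_finRange_split {l₁ l₂ : List (Fin n)} {i : Fin n}
    (hl : List.finRange n = l₁ ++ i :: l₂) : i ∉ l₁ ∧ i ∉ l₂ ∧ (l₁ ++ l₂).Nodup ∧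
      ∀ j, j ≠ i → j ∈ l₁ ++ l₂ := by
  have hn := List.nodup_finRange n
  rw [hl, List.nodup_middle, List.nodup_cons, List.mem_append, not_or] at hn
  refine ⟨hn.1.1, hn.1.2, hn.2, fun j hj => ?_⟩
  have := List.mem_finRange j
  rw [hl] at this
  simpa [hj] using this

/-- All letters except `i` fix `ω i`, and the letter `i` subtracts `α i`, which the prefix then
moves. -/
theorem weight_sub_coxeter (h : IsWeightedSystem W α ω) {l₁ l₂ : List (Fin n)} {i : Fin n}
    (hl : List.finRange n = l₁ ++ i :: l₂) :
    ω i - coxeter α (ω i) = wordProd α l₁ (α i) := by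
  obtain ⟨h1, h2, -, -⟩ := not_mem_of_finRange_split hl
  have h3 : (2 * inner ℝ (α i) (ω i)) = (1 : ℝ) := by
    rw [real_inner_comm, h.inner_weight, if_pos rfl]
    norm_num
  rw [coxeter, hl, wordProd_append, wordProd_cons, mul_apply, mul_apply, h.wordProd_weight h2,
    h.simple_apply, map_sub, h.wordProd_weight h1, h3, one_smul, sub_sub_cancel]

theorem exists_weight_sub_coxeter (h : IsWeightedSystem W α ω) {β : V} (hβ : β ∈ roots W)
    (hp : IsPositive ω β) (hn : IsPositive ω (-((coxeter α)⁻¹ β))) :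
    ∃ i, ω i - coxeter α (ω i) = β := by
  obtain ⟨l₁, i, l₂, hl, he⟩ := h.exists_prefix_of_neg _ hβ hp hn
  exact ⟨i, (h.weight_sub_coxeter hl).trans he.symm⟩

theorem weight_sub_coxeter_mem_roots (h : IsWeightedSystem W α ω) (i : Fin n) :
    ω i - coxeter α (ω i) ∈ roots W := by
  obtain ⟨l₁, l₂, hl⟩ := List.append_of_mem (List.mem_finRange i)
  rw [h.weight_sub_coxeter hl]
  exact apply_mem_roots (h.wordProd_mem _) (h.mem_roots i)

/-- The orbit sum is fixed by `c`, which has no nonzero fixed vector. -/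
theorem sum_coxeter_pow_apply (h : IsWeightedSystem W α ω) {N : ℕ} (hN : coxeter α ^ N = 1)
    (x : V) : ∑ m ∈ Finset.range N, (coxeter α ^ m) x = 0 := by
  refine h.eq_zero_of_coxeter_apply ?_
  rw [map_sum]
  have h1 : ∀ m, coxeter α ((coxeter α ^ m) x) = (coxeter α ^ (m + 1)) x := by
    intro m
    rw [← mul_apply, pow_succ']
  simp_rw [h1]
  have h2 := Finset.sum_range_succ' (fun m => (coxeter α ^ m) x) N
  rw [Finset.sum_range_succ, hN, pow_zero] at h2
  exact (add_right_cancel h2).symm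

/-- Every orbit of a Coxeter element on roots contains negative roots. -/
theorem exists_neg_coxeter_pow (h : IsWeightedSystem W α ω) {N : ℕ} (hN : coxeter α ^ N = 1)
    (hN0 : 0 < N) {β : V} (hβ : β ∈ roots W) :
    ∃ m : ℕ, IsPositive ω (-((coxeter α ^ m) β)) := by
  by_contra! hc
  have hp : ∀ m : ℕ, IsPositive ω ((coxeter α ^ m) β) := fun m =>
    (h.isPositive_or_neg (apply_mem_roots (W.pow_mem h.coxeter_mem m) hβ)).resolve_right (hc m)
  refine ne_zero_of_mem_roots hβ (h.eq_zero_of_inner_weight fun i => ?_)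
  have h1 : ∑ m ∈ Finset.range N, inner ℝ (ω i) ((coxeter α ^ m) β) = (0 : ℝ) := by
    rw [← inner_sum, h.sum_coxeter_pow_apply hN, inner_zero_right]
  exact (Finset.sum_eq_zero_iff_of_nonneg fun m _ => hp m i).1 h1 0 (Finset.mem_range.2 hN0)

/-- Every orbit of a Coxeter element on roots meets the `n` roots `(1 - c) ω i`. -/
theorem exists_coxeter_pow_apply_eq (h : IsWeightedSystem W α ω) [Finite W] {β : V}
    (hβ : β ∈ roots W) :
    ∃ (m : ℕ) (i : Fin n), (coxeter α ^ m) β = ω i - coxeter α (ω i) := by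
  obtain ⟨N, hN0, hN⟩ : ∃ N : ℕ, 0 < N ∧ coxeter α ^ N = 1 := by
    obtain ⟨N, hN0, hN⟩ := (isOfFinOrder_of_finite (⟨_, h.coxeter_mem⟩ : W)).exists_pow_eq_one
    exact ⟨N, hN0, congrArg Subtype.val hN⟩
  have hr : ∀ m : ℕ, (coxeter α ^ m) β ∈ roots W := fun m =>
    apply_mem_roots (W.pow_mem h.coxeter_mem m) hβ
  obtain ⟨m, hm⟩ := h.exists_neg_coxeter_pow hN hN0 hβ
  -- Otherwise the orbit would stay negative from the `m`-th term on, although the orbit of the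
  -- opposite root also contains a negative root.
  have hstep : ∃ k : ℕ, IsPositive ω (-((coxeter α ^ k) β)) ∧
      IsPositive ω ((coxeter α ^ (k + 1)) β) := by
    by_contra! hc
    have hall : ∀ k, IsPositive ω (-((coxeter α ^ (k + m)) β)) := by
      intro k
      induction k with
      | zero => rwa [Nat.zero_add]
      | succ k ih =>
        have := (h.isPositive_or_neg (hr (k + m + 1))).resolve_left (hc _ ih)
        rwa [show k + 1 + m = k + m + 1 by ring]
    obtain ⟨k, hk⟩ := h.exists_neg_coxeter_pow hN hN0 (neg_mem_roots (hr m))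
    rw [map_neg, ← mul_apply, ← pow_add] at hk
    exact h.not_isPositive_neg (neg_ne_zero.2 (ne_zero_of_mem_roots (hr _))) (hall k) hk
  obtain ⟨k, hk1, hk2⟩ := hstep
  obtain ⟨i, hi⟩ := h.exists_weight_sub_coxeter (hr _) hk2 (by
    rwa [pow_succ', mul_apply, inv_apply_self])
  exact ⟨k + 1, i, hi.symm⟩

/-- The Coxeter orbit of a fundamental weight contains the negative of one. -/
theorem exists_coxeter_pow_weight_eq_neg (h : IsWeightedSystem W α ω) [Finite W] (i : Fin n) :
    ∃ (m : ℕ) (k : Fin n), (coxeter α ^ m) (ω i) = -ω k := by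
  -- Move the negative of the root `(1 - c) (ω i)` to some `(1 - c) (ω k)`, then cancel `1 - c`.
  obtain ⟨m, k, hk⟩ := h.exists_coxeter_pow_apply_eq
    (neg_mem_roots (h.weight_sub_coxeter_mem_roots i))
  refine ⟨m, k, h.eq_of_sub_coxeter_eq ?_⟩
  have hcomm : coxeter α ((coxeter α ^ m) (ω i)) = (coxeter α ^ m) (coxeter α (ω i)) := by
    rw [← mul_apply, ← mul_apply, ← pow_succ', pow_succ]
  rw [map_neg, map_sub] at hk
  rw [hcomm, map_neg]
  rw [← neg_inj, hk]
  abel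

/-- Conjugate lines spanned by fundamental weights lie in one Coxeter orbit. -/
theorem span_weight_mem_orbit_coxeter (h : IsWeightedSystem W α ω) [Finite W]
    (hW : Subgroup.closure (reflections W) = W) {i j : Fin n}
    (hij : Submodule.span ℝ {ω j} ∈ orbit W (Submodule.span ℝ {ω i})) :
    Submodule.span ℝ {ω j} ∈ orbit (Subgroup.zpowers (coxeter α)) (Submodule.span ℝ {ω i}) := by
  obtain ⟨w, hw, he⟩ := hij
  rw [translate_span_singleton] at he
  obtain ⟨a, ha⟩ := Submodule.mem_span_singleton.1
    (he ▸ Submodule.mem_span_singleton_self (ω j))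
  have ha0 : a ≠ 0 := by
    rintro rfl
    exact h.weight_ne_zero j (by rw [← ha, zero_smul])
  have key : ∀ (g : V ≃ₗᵢ[ℝ] V) (_ : g ∈ W) (b : ℝ) (_ : 0 < b) (k : Fin n),
      g (b • ω k) = ω j → b • ω k = ω j := by
    intro g hg b hb k hgk
    have hd : IsDominant α (b • ω k) := fun l => by
      rw [real_inner_smul_right]
      exact mul_nonneg hb.le (h.isDominant_weight k l)
    rw [← h.eq_of_isDominant hW hg hd (by rw [hgk]; exact h.isDominant_weight j), hgk]
  rcases lt_or_gt_of_ne ha0 with hneg | hpos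
  · obtain ⟨m, k, hk⟩ := h.exists_coxeter_pow_weight_eq_neg i
    have h1 := key (w * (coxeter α ^ m)⁻¹)
      (W.mul_mem hw (W.inv_mem (W.pow_mem h.coxeter_mem m))) (-a) (neg_pos.2 hneg) k (by
        rw [neg_smul, ← smul_neg, ← hk, mul_apply, map_smul, inv_apply_self, map_smul, ha])
    refine ⟨coxeter α ^ m, Subgroup.npow_mem_zpowers _ m, ?_⟩
    rw [translate_span_singleton, hk, ← h1, neg_smul, ← smul_neg]
    exact Submodule.span_singleton_smul_eq (IsUnit.mk0 a ha0) _
  · have h1 := key w hw a hpos i (by rw [map_smul, ha])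
    refine ⟨1, Subgroup.one_mem _, ?_⟩
    rw [translate_one, ← h1]
    exact Submodule.span_singleton_smul_eq (IsUnit.mk0 a ha0) _

/-! ### Noncrossing lines -/

theorem finrank_eq (h : IsWeightedSystem W α ω) : Module.finrank ℝ V = n := by
  have hli : LinearIndependent ℝ α := by
    rw [Fintype.linearIndependent_iff]
    intro g hg i
    have := congrArg (inner ℝ (ω i)) hg
    simp only [inner_sum, real_inner_smul_right, h.inner_weight, inner_zero_right] at this
    simpa using this
  have hs : ⊤ ≤ Submodule.span ℝ (Set.range α) := by
    intro x _
    rw [h.expand x]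
    exact Submodule.sum_mem _ fun i _ => Submodule.smul_mem _ _
      (Submodule.subset_span (Set.mem_range_self i))
  rw [Module.finrank_eq_card_basis (Module.Basis.mk hli hs), Fintype.card_fin]

theorem reflectionLength_wordProd_le (h : IsWeightedSystem W α ω) (l : List (Fin n)) :
    reflectionLength W (wordProd α l) ≤ l.length := by
  rw [← List.length_map (fun i => hyperplaneReflection (α i))]
  refine reflectionLength_le fun t ht => ?_
  obtain ⟨i, -, rfl⟩ := List.mem_map.1 ht
  exact mem_reflections_iff.2 ⟨_, h.mem_roots i, rfl⟩

theorem reflectionLength_coxeter (h : IsWeightedSystem W α ω) [FiniteDimensional ℝ V]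
    (hW : Subgroup.closure (reflections W) = W) : reflectionLength W (coxeter α) = n := by
  refine le_antisymm ?_ ?_
  · simpa [coxeter] using h.reflectionLength_wordProd_le (List.finRange n)
  · have h1 := finrank_le_fixedSpace_add_reflectionLength hW h.coxeter_mem
    have h2 : fixedSpace (coxeter α) = ⊥ :=
      (Submodule.eq_bot_iff _).2 fun x hx => h.eq_zero_of_coxeter_apply hx
    rwa [h.finrank_eq, h2, finrank_bot, Nat.zero_add] at h1

theorem reflectionLength_reflection_le {β : V} (hβ : β ∈ roots W) :
    reflectionLength W (hyperplaneReflection β) ≤ 1 := by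
  have := reflectionLength_le (W := W) (l := [hyperplaneReflection β])
    (by simpa using mem_reflections_iff.2 ⟨β, hβ, rfl⟩)
  simpa using this

theorem reflectionLength_mul_le (hW : Subgroup.closure (reflections W) = W) {u v : V ≃ₗᵢ[ℝ] V}
    (hu : u ∈ W) (hv : v ∈ W) :
    reflectionLength W (u * v) ≤ reflectionLength W u + reflectionLength W v := by
  obtain ⟨l, h1, h2, rfl⟩ := exists_reduced_word hW hu
  obtain ⟨m, h3, h4, rfl⟩ := exists_reduced_word hW hv
  rw [← h1, ← h3, ← List.prod_append, ← List.length_append]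
  exact reflectionLength_le fun t ht => (List.mem_append.1 ht).elim (h2 t) (h4 t)

/-- The witness is the Coxeter element with the letter `i` removed; it differs from `c` by one
reflection. -/
theorem isNoncrossingLine_span_weight (h : IsWeightedSystem W α ω) [FiniteDimensional ℝ V]
    (hW : Subgroup.closure (reflections W) = W) (i : Fin n) :
    IsNoncrossingLine W (coxeter α) (Submodule.span ℝ {ω i}) := by
  obtain ⟨l₁, l₂, hl⟩ := List.append_of_mem (List.mem_finRange i)
  obtain ⟨h1, h2, h3, h4⟩ := not_mem_of_finRange_split hl
  have hline : ∀ x, (∀ j, j ≠ i → inner ℝ (α j) x = 0) ↔ x ∈ Submodule.span ℝ {ω i} := by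
    intro x
    rw [Submodule.mem_span_singleton]
    constructor
    · exact fun hx => ⟨_, (h.eq_smul_weight hx).symm⟩
    · rintro ⟨a, rfl⟩ j hj
      rw [real_inner_smul_right, real_inner_comm, h.inner_weight, if_neg (Ne.symm hj), mul_zero]
  refine ⟨⟨⟨α '' {j | j ≠ i}, ?_, ?_⟩, wordProd α (l₁ ++ l₂), h.wordProd_mem _, ?_, ?_⟩,
    finrank_span_singleton (h.weight_ne_zero i)⟩
  · rintro _ ⟨j, -, rfl⟩
    exact h.mem_roots j
  · ext x
    rw [mem_iInf_orthogonal, Set.forall_mem_image]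
    exact (hline x).symm
  · have hinv : (wordProd α (l₁ ++ l₂))⁻¹ * coxeter α =
        hyperplaneReflection ((wordProd α l₂)⁻¹ (α i)) := by
      rw [← conj_hyperplaneReflection (h.mem_roots i).1, coxeter, hl, wordProd_append,
        wordProd_append, wordProd_cons]
      group
    have hr := reflectionLength_reflection_le
      (apply_mem_roots (W.inv_mem (h.wordProd_mem l₂)) (h.mem_roots i))
    -- The two factors have lengths at most `n - 1` and `1`, while their product has length `n`;
    -- subadditivity forces equality.
    have hmul := reflectionLength_mul_le hW (h.wordProd_mem (l₁ ++ l₂))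
      (W.mul_mem (W.inv_mem (h.wordProd_mem (l₁ ++ l₂))) h.coxeter_mem)
    have hw := h.reflectionLength_wordProd_le (l₁ ++ l₂)
    have hlen := congrArg List.length hl
    rw [mul_inv_cancel_left] at hmul
    rw [AbsoluteLE]
    rw [hinv] at hmul ⊢
    rw [h.reflectionLength_coxeter hW] at hmul ⊢
    simp only [List.length_finRange, List.length_append, List.length_cons] at hlen hw
    omega
  · ext x
    rw [← hline, mem_fixedSpace]
    constructor
    · refine fun hx => h.wordProd_apply_of_inner_eq_zero fun j hj => hx j ?_
      rintro rfl
      exact (List.mem_append.1 hj).elim h1 h2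
    · exact fun hx j hj => h.inner_eq_zero_of_wordProd_apply h3 hx j (h4 j hj)

/-- The noncrossing lines are the translates under the Coxeter element of the lines spanned by
fundamental weights. -/
theorem isNoncrossingLine_iff (h : IsWeightedSystem W α ω) [FiniteDimensional ℝ V] [Finite W]
    (hW : Subgroup.closure (reflections W) = W) {X : Submodule ℝ V} :
    IsNoncrossingLine W (coxeter α) X ↔
      ∃ i, X ∈ orbit (Subgroup.zpowers (coxeter α)) (Submodule.span ℝ {ω i}) := by
  constructor
  · rintro ⟨⟨-, w, hw, hle, rfl⟩, h1⟩
    have hwc := W.mul_mem (W.inv_mem hw) h.coxeter_mem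
    have hlw := finrank_le_fixedSpace_add_reflectionLength hW hw
    rw [AbsoluteLE, h.reflectionLength_coxeter hW] at hle
    rw [h.finrank_eq, h1] at hlw
    obtain ⟨x, hx, hx0⟩ : ∃ x ∈ fixedSpace w, x ≠ 0 := by
      refine (fixedSpace w).ne_bot_iff.1 fun hb => ?_
      rw [hb, finrank_bot] at h1
      exact zero_ne_one h1
    obtain ⟨l, hl1, hl2, hl3⟩ := exists_reduced_word hW hwc
    -- The dimension bound gives `ℓ_T(w⁻¹ c) ≤ 1`. Length zero would make `c` fix `x ≠ 0`, so `c = w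
    -- t` with `t` a reflection, and `x - c x` is a multiple of `w β`.
    obtain ⟨β, hβ, a, hxa⟩ : ∃ β ∈ roots W, ∃ a : ℝ, x - coxeter α x = a • β := by
      match l, hl1, hl2, hl3 with
      | [], _, _, hl3 =>
        rw [List.prod_nil, eq_comm, inv_mul_eq_one] at hl3
        subst hl3
        exact absurd (h.eq_zero_of_coxeter_apply hx) hx0
      | [t], _, hl2, hl3 =>
        obtain ⟨β, hβ, rfl⟩ := mem_reflections_iff.1 (hl2 t (by simp))
        rw [List.prod_singleton, eq_inv_mul_iff_mul_eq] at hl3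
        refine ⟨w β, apply_mem_roots hw hβ, 2 * inner ℝ β x, ?_⟩
        rw [← hl3, mul_apply, hyperplaneReflection_apply hβ.1, map_sub, map_smul,
          mem_fixedSpace.1 hx, sub_sub_cancel]
      | _ :: _ :: _, hl1, _, _ =>
        simp only [List.length_cons] at hl1
        omega
    obtain ⟨m, i, hi⟩ := h.exists_coxeter_pow_apply_eq hβ
    have hmx : (coxeter α ^ m) x = a • ω i := by
      refine h.eq_of_sub_coxeter_eq ?_
      rw [map_smul, ← smul_sub, ← hi, ← map_smul, ← hxa, map_sub, ← mul_apply, ← mul_apply,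
        ← pow_succ', pow_succ]
    have ha0 : a ≠ 0 := by
      rintro rfl
      rw [zero_smul, map_eq_zero_iff _ (coxeter α ^ m).injective] at hmx
      exact hx0 hmx
    refine ⟨i, (coxeter α ^ m)⁻¹,
      Subgroup.inv_mem _ (Subgroup.npow_mem_zpowers _ m), ?_⟩
    have hxs : (coxeter α ^ m)⁻¹ (ω i) = a⁻¹ • x := by
      rw [← inv_apply_self (coxeter α ^ m) x, hmx, map_smul, inv_smul_smul₀ ha0]
    rw [translate_span_singleton, hxs,
      Submodule.span_singleton_smul_eq (IsUnit.mk0 _ (inv_ne_zero ha0))]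
    refine (Submodule.eq_of_le_of_finrank_eq ?_ ?_).symm
    · rwa [Submodule.span_singleton_le_iff_mem]
    · rw [h1, finrank_span_singleton hx0]
  · rintro ⟨i, g, hg, rfl⟩
    obtain ⟨k, rfl⟩ := Subgroup.mem_zpowers_iff.1 hg
    exact (h.isNoncrossingLine_span_weight hW i).translate hW h.coxeter_mem
      (W.zpow_mem h.coxeter_mem k) (by group)

end IsWeightedSystem

/-! ### Orbits of noncrossing lines -/

theorem mem_orbit_trans {G : Subgroup (V ≃ₗᵢ[ℝ] V)} {X Y Z : Submodule ℝ V}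
    (h₁ : Y ∈ orbit G X) (h₂ : Z ∈ orbit G Y) : Z ∈ orbit G X :=
  (orbitSetoid G).trans' h₁ h₂

theorem mem_orbit_symm {G : Subgroup (V ≃ₗᵢ[ℝ] V)} {X Y : Submodule ℝ V}
    (h : Y ∈ orbit G X) : X ∈ orbit G Y :=
  (orbitSetoid G).symm' h

theorem orbit_mono {G H : Subgroup (V ≃ₗᵢ[ℝ] V)} (hGH : G ≤ H) (X : Submodule ℝ V) :
    orbit G X ⊆ orbit H X := fun _ ⟨g, hg, he⟩ => ⟨g, hGH hg, he⟩

/-- Formal passage to quotients, shared by the trivial group and the main case. -/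
theorem bijective_of_orbits {W : Subgroup (V ≃ₗᵢ[ℝ] V)} {c : V ≃ₗᵢ[ℝ] V} (hc : c ∈ W)
    (hC : ∀ X, IsNoncrossingLine W c X → ∀ Y ∈ orbit (Subgroup.zpowers c) X,
      IsNoncrossingLine W c Y)
    (hinj : ∀ X Y, IsNoncrossingLine W c X → IsNoncrossingLine W c Y → Y ∈ orbit W X →
      Y ∈ orbit (Subgroup.zpowers c) X)
    (hsurj : ∀ X, IsLine W X → ∃ Y ∈ orbit W X, IsNoncrossingLine W c Y) :
    (∀ X : Submodule ℝ V, IsNoncrossingLine W c X →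
      {Y | IsNoncrossingLine W c Y ∧ Y ∈ orbit W X} = orbit (Subgroup.zpowers c) X) ∧
    ∃ φ : NoncrossingLineOrbits W c → LineOrbits W,
      (∀ (X : Submodule ℝ V) (hX : IsNoncrossingLine W c X),
        φ (noncrossingLineOrbit W c X hX) = lineOrbit W X hX.isLine) ∧
      Function.Bijective φ := by
  have hle : Subgroup.zpowers c ≤ W := Subgroup.zpowers_le.2 hc
  refine ⟨fun X hX => Set.Subset.antisymm (fun Y hY => hinj X Y hX hY.1 hY.2)
    fun Y hY => ⟨hC X hX Y hY, orbit_mono hle X hY⟩, ?_⟩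
  refine ⟨Quotient.map' (fun X => ⟨X.1, X.2.isLine⟩) fun X Y hXY => orbit_mono hle _ hXY,
    fun X hX => rfl, ?_, ?_⟩
  · rintro ⟨X, hX⟩ ⟨Y, hY⟩ hXY
    exact Quotient.sound (hinj X Y hX hY (Quotient.exact hXY))
  · rintro ⟨X, hX⟩
    obtain ⟨Y, hY, hYn⟩ := hsurj X hX
    exact ⟨noncrossingLineOrbit W c Y hYn, Quotient.sound (mem_orbit_symm hY)⟩

/-- Every root lies in the span of the simple roots, so each reflection preserves that span and
irreducibility applies. -/
theorem IsIrreducibleReflectionGroup.span_simple {W : Subgroup (V ≃ₗᵢ[ℝ] V)}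
    (hW : IsIrreducibleReflectionGroup W) {n : ℕ} {α : Fin n → V} (hα : IsSimpleSystem W α) :
    Submodule.span ℝ (Set.range α) = ⊥ ∨ Submodule.span ℝ (Set.range α) = ⊤ := by
  refine hW.irreducible _ fun w hw => ?_
  rw [← hW.generated] at hw
  have hrefl : ∀ t ∈ reflections W, ∀ x ∈ Submodule.span ℝ (Set.range α),
      t x ∈ Submodule.span ℝ (Set.range α) := by
    intro t ht x hx
    obtain ⟨β, hβ, rfl⟩ := mem_reflections_iff.1 ht
    obtain ⟨a, rfl, -⟩ := hα.sign β hβ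
    rw [hyperplaneReflection_apply hβ.1]
    exact Submodule.sub_mem _ hx (Submodule.smul_mem _ _ (Submodule.sum_mem _ fun i _ =>
      Submodule.smul_mem _ _ (Submodule.subset_span (Set.mem_range_self i))))
  induction hw using Subgroup.closure_induction_left with
  | one => exact fun x hx => hx
  | mul_left t ht y _ ih => exact fun x hx => hrefl t ht _ (ih x hx)
  | inv_mul_cancel t ht y _ ih =>
    obtain ⟨β, -, rfl⟩ := mem_reflections_iff.1 ht
    rw [hyperplaneReflection_inv]
    exact fun x hx => hrefl _ ht _ (ih x hx)

/-- The degenerate case: the trivial group, acting on a one-dimensional space. -/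
theorem IsIrreducibleReflectionGroup.eq_bot_of_span_simple {W : Subgroup (V ≃ₗᵢ[ℝ] V)}
    (hW : IsIrreducibleReflectionGroup W) {n : ℕ} {α : Fin n → V} (hα : IsSimpleSystem W α)
    (hs : Submodule.span ℝ (Set.range α) = ⊥) : n = 0 ∧ W = ⊥ := by
  have hn : n = 0 := by
    by_contra hn
    refine hα.linearIndependent.ne_zero ⟨0, Nat.pos_of_ne_zero hn⟩ ?_
    rw [← Submodule.mem_bot ℝ, ← hs]
    exact Submodule.subset_span (Set.mem_range_self _)
  refine ⟨hn, ?_⟩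
  rw [← hW.generated, Subgroup.closure_eq_bot_iff]
  intro t ht
  obtain ⟨β, hβ, rfl⟩ := mem_reflections_iff.1 ht
  obtain ⟨a, rfl, -⟩ := hα.sign β hβ
  subst hn
  simpa using hβ.1

theorem isNoncrossingLine_one {W : Subgroup (V ≃ₗᵢ[ℝ] V)} (hW : IsIrreducibleReflectionGroup W)
    (hbot : W = ⊥) {X : Submodule ℝ V} (hX : IsLine W X) :
    X = ⊤ ∧ IsNoncrossingLine W 1 X := by
  have htop : X = ⊤ := by
    refine (hW.irreducible X fun w hw x hx => ?_).resolve_left ?_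
    · rw [hbot, Subgroup.mem_bot] at hw
      rwa [hw]
    · rintro rfl
      simpa using hX.2
  have h0 : reflectionLength W 1 = 0 :=
    Nat.le_zero.1 (reflectionLength_le (W := W) (l := []) (by simp))
  refine ⟨htop, ⟨hX.1, 1, W.one_mem, ?_, ?_⟩, hX.2⟩
  · rw [AbsoluteLE, inv_one, mul_one, h0]
  · rw [htop]
    ext x
    simp [mem_fixedSpace]

end NoncrossingLines

theorem mainTheorem12 {V : Type*} [NormedAddCommGroup V] [InnerProductSpace ℝ V]
    [FiniteDimensional ℝ V] (W : Subgroup (V ≃ₗᵢ[ℝ] V))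
    (hW : NoncrossingLines.IsIrreducibleReflectionGroup W)
    (c : V ≃ₗᵢ[ℝ] V) (hc : NoncrossingLines.IsCoxeterElement W c) :
    (∀ X : Submodule ℝ V, NoncrossingLines.IsNoncrossingLine W c X →
      {Y | NoncrossingLines.IsNoncrossingLine W c Y ∧ Y ∈ NoncrossingLines.orbit W X} =
        NoncrossingLines.orbit (Subgroup.zpowers c) X) ∧
    ∃ φ : NoncrossingLines.NoncrossingLineOrbits W c → NoncrossingLines.LineOrbits W,
      (∀ (X : Submodule ℝ V) (hX : NoncrossingLines.IsNoncrossingLine W c X),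
        φ (NoncrossingLines.noncrossingLineOrbit W c X hX) =
          NoncrossingLines.lineOrbit W X hX.isLine) ∧
      Function.Bijective φ := by
  open NoncrossingLines in
  obtain ⟨n, α, hα, hcα⟩ := hc
  have hcα : c = coxeter α := by rw [hcα, List.ofFn_eq_map]; rfl
  subst hcα
  have := hW.finite
  rcases hW.span_simple hα with hs | hs
  · obtain ⟨rfl, hbot⟩ := hW.eq_bot_of_span_simple hα hs
    have hc1 : coxeter α = 1 := by simp [coxeter, wordProd]
    rw [hc1]
    refine bijective_of_orbits W.one_mem ?_ ?_ ?_
    · rintro X hX Y ⟨g, hg, rfl⟩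
      rw [Subgroup.zpowers_one_eq_bot, Subgroup.mem_bot] at hg
      rwa [hg, translate_one]
    · intro X Y hX hY _
      refine ⟨1, Subgroup.one_mem _, ?_⟩
      rw [translate_one, (isNoncrossingLine_one hW hbot hX.isLine).1,
        (isNoncrossingLine_one hW hbot hY.isLine).1]
    · exact fun X hX => ⟨X, ⟨1, W.one_mem, (translate_one X).symm⟩,
        (isNoncrossingLine_one hW hbot hX).2⟩
  · obtain ⟨ω, h⟩ := hα.exists_weights hs.ge
    have hle : Subgroup.zpowers (coxeter α) ≤ W := Subgroup.zpowers_le.2 h.coxeter_mem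
    refine bijective_of_orbits h.coxeter_mem ?_ ?_ ?_
    · intro X hX Y hY
      obtain ⟨i, hi⟩ := (h.isNoncrossingLine_iff hW.generated).1 hX
      exact (h.isNoncrossingLine_iff hW.generated).2 ⟨i, mem_orbit_trans hi hY⟩
    · intro X Y hX hY hXY
      obtain ⟨i, hi⟩ := (h.isNoncrossingLine_iff hW.generated).1 hX
      obtain ⟨j, hj⟩ := (h.isNoncrossingLine_iff hW.generated).1 hY
      have hij := h.span_weight_mem_orbit_coxeter hW.generated
        (mem_orbit_trans (mem_orbit_trans (orbit_mono hle _ hi) hXY)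
          (mem_orbit_symm (orbit_mono hle _ hj)))
      exact mem_orbit_trans (mem_orbit_trans (mem_orbit_symm hi) hij) hj
    · intro X hX
      obtain ⟨w, hw, i, he⟩ := h.exists_translate_eq_span_weight hX
      exact ⟨_, ⟨w, hw, he.symm⟩, h.isNoncrossingLine_span_weight hW.generated i⟩
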